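/- Let $q$ be a complex number with $0<|q|<1$ and let $\ell\ge 0$ be an integer. For $a\in\mathbb{C}$ and a base $p$ with $|p|<1$ write $(a;p)_n=\prod_{j=1}^{n}(1-ap^{j-1})$ for $n\ge 0$ (so $(a;p)_0=1$), $(a;p)_\infty=\prod_{n\ge 0}(1-ap^n)$ and $(a)_n=(a;q)_n$. For an integer $n\ge 0$ and $k\in\mathbb{Z}$ let ${n\brack k}_p=\dfrac{(p;p)_n}{(p;p)_k\,(p;p)_{n-k}}$ if $0\le k\le n$ and ${n\brack k}_p=0$ otherwise, and write ${n\brack k}={n\brack k}_q$. Let $\binom{m+1}{2}=m(m+1)/2$ for every integer $m$. Then \begin{align*} &\sum_{n=0}^{\infty} \frac{q^{2n^2}}{(q^2; q^2)_{2n}} \sum_{m=-\infty}^{\infty} \sum_{k=0}^{\ell} (-1)^m q^{(2m+2k-\ell)^2+ \binom{m+1}{2}} {\ell \brack k}\\ &\qquad\cdot \left({2n \brack n-2m-2k+\ell}_{q^2} -q^{4(2m+2k-\ell+1)} {2n \brack n-2m-2k+\ell-2}_{q^2} \right) \\ &=\frac{2}{(q^2; q^2)_\infty} \sum_{j=0}^{\infty}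 (-1)^j q^{\binom{j+1}{2} + 3(2j+\ell)^2} \left(1-q^{12(2j+\ell+1)} \right) (q^{j+1})_{\ell}, \end{align*} where for each $n$ the sum over $m$ has only finitely many nonzero terms, and the sums over $n$ and over $j$ converge absolutely. -/

import Mathlib

/-- The `q`-shifted factorial `(a; q)_n = ∏_{j=1}^n (1 - a q^{j-1})`. -/
noncomputable def qPoch (a q : ℂ) (n : ℕ) : ℂ :=
  ∏ j ∈ Finset.range n, (1 - a * q ^ j)

/-- The infinite `q`-shifted factorial `(a; q)_∞ = ∏_{n ≥ 0} (1 - a q^n)`. -/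
noncomputable def qPochInf (a q : ℂ) : ℂ :=
  ∏' n : ℕ, (1 - a * q ^ n)

/-- The product defining `(a; q)_∞` converges (unconditionally) for `|q| < 1`. -/
theorem multipliable_qPochInf (a q : ℂ) (hq : ‖q‖ < 1) :
    Multipliable (fun n : ℕ => 1 - a * q ^ n) := by
  have h : Summable (fun n : ℕ => ‖-(a * q ^ n)‖) := by
    have := (summable_geometric_of_lt_one (norm_nonneg q) hq).mul_left ‖a‖
    simpa [norm_mul, norm_pow] using this
  simpa [sub_eq_add_neg] using multipliable_one_add_of_summable h

/-- The Gaussian polynomial `[n, k]_q = (q; q)_n / ((q; q)_k (q; q)_{n-k})`, extended by zero to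
the integers `k` outside `0 ≤ k ≤ n`. -/
noncomputable def qBinom (q : ℂ) (n : ℕ) (k : ℤ) : ℂ :=
  if 0 ≤ k ∧ k ≤ n then
    qPoch q q n / (qPoch q q k.toNat * qPoch q q (n - k.toNat))
  else 0

open Filter Topology

/-! Sum over `n` first. With `r = 2(m + k) - ℓ` and `p = q^2`, the identity `r^2 + 4(r + 1) = (r +
2)^2` turns the bracket on the left into a difference of the same expression at `r` and at `r + 2`.
The Durfee rectangle identity gives `∑ₙ p^(n^2) / ((p)_{n-r} (p)_{n+r}) = p^(r^2) / (p)_∞`, so the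
weight `q^(r^2)` becomes `q^(3r^2)` (`hasSum_rectDiff`).

The new weight depends only on `N = m + k`. For fixed `N`, Rothe's finite `q`-binomial theorem
collapses the sum over `k` to `(-1)^N q^(N(N+1)/2) (q^(-N))_ℓ` (`sum_thetaCoeff_sub_mul_qBinom`).
This vanishes for `0 ≤ N < ℓ`; the terms `N = j + ℓ` and `N = -(j + 1)` both equal the `j`-th term
on the right, whence the factor 2 (`hasSum_diagTerm`).

The exchange of summations rests on a bound for the rectangle terms that is geometric in `n` and
uniform in `r`, times the absolutely summable theta coefficients (`summable_lhsTerm`). -/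

theorem qPoch_succ (a q : ℂ) (n : ℕ) : qPoch a q (n + 1) = qPoch a q n * (1 - a * q ^ n) :=
  Finset.prod_range_succ _ _

theorem qPoch_self_succ (p : ℂ) (n : ℕ) : qPoch p p (n + 1) = qPoch p p n * (1 - p ^ (n + 1)) := by
  rw [qPoch_succ, pow_succ']

theorem one_sub_pow_ne_zero {p : ℂ} (hp : ‖p‖ < 1) (n : ℕ) : 1 - p ^ (n + 1) ≠ 0 := by
  intro h
  have h1 : ‖p ^ (n + 1)‖ = 1 := by rw [← sub_eq_zero.mp h, norm_one]
  rw [norm_pow] at h1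
  exact (pow_lt_one₀ (norm_nonneg p) hp (Nat.succ_ne_zero n)).ne h1

theorem qPoch_self_ne_zero {p : ℂ} (hp : ‖p‖ < 1) (n : ℕ) : qPoch p p n ≠ 0 := by
  refine Finset.prod_ne_zero_iff.mpr fun j _ => ?_
  rw [← pow_succ']
  exact one_sub_pow_ne_zero hp j

theorem tendsto_qPoch {a q : ℂ} (hq : ‖q‖ < 1) :
    Tendsto (qPoch a q) atTop (𝓝 (qPochInf a q)) :=
  (multipliable_qPochInf a q hq).tendsto_prod_tprod_nat

theorem qPochInf_self_ne_zero {p : ℂ} (hp : ‖p‖ < 1) : qPochInf p p ≠ 0 := by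
  have h := tprod_one_add_ne_zero_of_summable (f := fun n : ℕ => -(p * p ^ n)) (fun n => by
    rw [← sub_eq_add_neg, ← pow_succ']
    exact one_sub_pow_ne_zero hp n) (by
    simpa [norm_mul, norm_pow] using
      (summable_geometric_of_lt_one (norm_nonneg p) hp).mul_left ‖p‖)
  simpa [qPochInf, sub_eq_add_neg] using h

theorem exists_norm_qPoch_self_inv_le {p : ℂ} (hp : ‖p‖ < 1) :
    ∃ C : ℝ, 0 ≤ C ∧ ∀ n, ‖(qPoch p p n)⁻¹‖ ≤ C := by
  have h := ((tendsto_qPoch hp).inv₀ (qPochInf_self_ne_zero hp)).norm.bddAbove_range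
  obtain ⟨C, hC⟩ := h
  have hC' : ∀ n, ‖(qPoch p p n)⁻¹‖ ≤ C := fun n => hC ⟨n, rfl⟩
  exact ⟨C, (norm_nonneg _).trans (hC' 0), hC'⟩

/-! ### The Durfee rectangle identity -/

/-- The summand `p ^ (s ^ 2 + t s) / ((p)_s (p)_{s + t})` of the Durfee rectangle identity. -/
noncomputable def durfeeTerm (p : ℂ) (t s : ℕ) : ℂ :=
  p ^ (s ^ 2 + t * s) * ((qPoch p p s)⁻¹ * (qPoch p p (s + t))⁻¹)

theorem norm_durfeeTerm_le {p : ℂ} (hp : ‖p‖ < 1) {C : ℝ} (hC : ∀ n, ‖(qPoch p p n)⁻¹‖ ≤ C)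
    (t s : ℕ) : ‖durfeeTerm p t s‖ ≤ ‖p‖ ^ s * (C * C) := by
  have hC0 : 0 ≤ C := (norm_nonneg _).trans (hC 0)
  rw [durfeeTerm, norm_mul, norm_mul, norm_pow]
  have h : s ≤ s ^ 2 + t * s := by nlinarith [Nat.le_self_pow two_ne_zero s]
  exact mul_le_mul (pow_le_pow_of_le_one (norm_nonneg p) hp.le h)
    (mul_le_mul (hC _) (hC _) (norm_nonneg _) hC0) (by positivity) (by positivity)

theorem summable_durfeeTerm {p : ℂ} (hp : ‖p‖ < 1) (t : ℕ) : Summable (durfeeTerm p t) := by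
  obtain ⟨C, -, hC⟩ := exists_norm_qPoch_self_inv_le hp
  exact Summable.of_norm_bounded
    ((summable_geometric_of_lt_one (norm_nonneg p) hp).mul_right (C * C))
    (norm_durfeeTerm_le hp hC t)

/-- The split is made for telescoping: the first part vanishes at `s = 0`, so its index can be
shifted by one before it is recombined with the second. -/
theorem durfeeTerm_sub_succ {p : ℂ} (hp : ‖p‖ < 1) (t s : ℕ) :
    durfeeTerm p t s - durfeeTerm p (t + 1) s =
      p ^ (s ^ 2 + t * s) * ((qPoch p p s)⁻¹ * (qPoch p p (s + t + 1))⁻¹) * (1 - p ^ s)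
        - p ^ (s ^ 2 + t * s + (s + t + 1)) *
          ((qPoch p p s)⁻¹ * (qPoch p p (s + t + 1))⁻¹) := by
  have h1 := qPoch_self_ne_zero hp (s + t)
  have h2 := one_sub_pow_ne_zero hp (s + t)
  have h3 := qPoch_self_ne_zero hp s
  rw [durfeeTerm, durfeeTerm, ← add_assoc s t 1, qPoch_self_succ]
  field_simp
  ring

theorem durfeeTerm_telescope {p : ℂ} (hp : ‖p‖ < 1) (t s : ℕ) :
    p ^ ((s + 1) ^ 2 + t * (s + 1)) *
        ((qPoch p p (s + 1))⁻¹ * (qPoch p p (s + 1 + t + 1))⁻¹) * (1 - p ^ (s + 1))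
      - p ^ (s ^ 2 + t * s + (s + t + 1)) * ((qPoch p p s)⁻¹ * (qPoch p p (s + t + 1))⁻¹) =
      -p ^ (t + 1) * (durfeeTerm p (t + 1) s - durfeeTerm p (t + 2) s) := by
  have h1 := qPoch_self_ne_zero hp (s + t + 1)
  have h2 := one_sub_pow_ne_zero hp (s + t + 1)
  have h3 := qPoch_self_ne_zero hp s
  have h4 := one_sub_pow_ne_zero hp s
  rw [durfeeTerm, durfeeTerm, ← add_assoc s t 1, show s + 1 + t + 1 = s + t + 1 + 1 by ring,
    show s + (t + 2) = s + t + 1 + 1 by ring, qPoch_self_succ p s, qPoch_self_succ p (s + t + 1)]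
  field_simp
  ring

/-- Consecutive differences in `t` satisfy a contracting recursion, which forces them to vanish once
they are known to be bounded. -/
theorem tsum_durfeeTerm_sub {p : ℂ} (hp : ‖p‖ < 1) (t : ℕ) :
    ∑' s, durfeeTerm p t s - ∑' s, durfeeTerm p (t + 1) s =
      -p ^ (t + 1) * (∑' s, durfeeTerm p (t + 1) s - ∑' s, durfeeTerm p (t + 2) s) := by
  have hS := summable_durfeeTerm hp
  set U : ℕ → ℂ := fun s =>
    p ^ (s ^ 2 + t * s) * ((qPoch p p s)⁻¹ * (qPoch p p (s + t + 1))⁻¹) * (1 - p ^ s) with hU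
  set V : ℕ → ℂ := fun s => p ^ (s ^ 2 + t * s + (s + t + 1)) *
          ((qPoch p p s)⁻¹ * (qPoch p p (s + t + 1))⁻¹) with hV
  -- Rewriting `V` as a multiple of a Durfee summand is what makes it summable.
  have hVe : V = fun s => p ^ (t + 1) * durfeeTerm p (t + 1) s := by
    funext s
    simp only [hV, durfeeTerm, ← add_assoc]
    ring
  have hVs : Summable V := hVe ▸ (hS (t + 1)).mul_left _
  have hUe : U = fun s => durfeeTerm p t s - durfeeTerm p (t + 1) s + V s := by
    funext s
    rw [durfeeTerm_sub_succ hp, sub_add_cancel]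
  have hUs : Summable U := hUe ▸ ((hS t).sub (hS (t + 1))).add hVs
  rw [← (hS t).tsum_sub (hS (t + 1)), ← (hS (t + 1)).tsum_sub (hS (t + 2)), ← tsum_mul_left,
    tsum_congr (durfeeTerm_sub_succ hp t), hUs.tsum_sub hVs, hUs.tsum_eq_zero_add,
    show U 0 = 0 by simp [hU], zero_add,
    ← ((summable_nat_add_iff 1).mpr hUs).tsum_sub hVs]
  exact tsum_congr (durfeeTerm_telescope hp t)

theorem norm_tsum_durfeeTerm_le {p : ℂ} (hp : ‖p‖ < 1) {C : ℝ}
    (hC : ∀ n, ‖(qPoch p p n)⁻¹‖ ≤ C) (t : ℕ) :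
    ‖∑' s, durfeeTerm p t s‖ ≤ (1 - ‖p‖)⁻¹ * (C * C) :=
  tsum_of_norm_bounded ((hasSum_geometric_of_lt_one (norm_nonneg p) hp).mul_right (C * C))
    (norm_durfeeTerm_le hp hC t)

/-- Each use of the recursion gains a factor of norm at most `‖p‖`, while all differences obey one
uniform bound; iterating indefinitely leaves 0. -/
theorem tsum_durfeeTerm_succ {p : ℂ} (hp : ‖p‖ < 1) (t : ℕ) :
    ∑' s, durfeeTerm p (t + 1) s = ∑' s, durfeeTerm p t s := by
  obtain ⟨C, -, hC⟩ := exists_norm_qPoch_self_inv_le hp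
  set F : ℕ → ℂ := fun t => ∑' s, durfeeTerm p t s with hF
  set M : ℝ := (1 - ‖p‖)⁻¹ * (C * C)
  have hM : ∀ t, ‖F t - F (t + 1)‖ ≤ M + M := fun t =>
    (norm_sub_le _ _).trans
      (add_le_add (norm_tsum_durfeeTerm_le hp hC _) (norm_tsum_durfeeTerm_le hp hC _))
  have hbound : ∀ n t, ‖F t - F (t + 1)‖ ≤ ‖p‖ ^ n * (M + M) := by
    intro n
    induction n with
    | zero => simpa using hM
    | succ n ih =>
      intro t
      rw [show F t - F (t + 1) = -p ^ (t + 1) * (F (t + 1) - F (t + 2)) from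
        tsum_durfeeTerm_sub hp t, norm_mul, norm_neg, norm_pow, pow_succ' _ n, mul_assoc]
      gcongr
      · exact pow_le_of_le_one (norm_nonneg p) hp.le (Nat.succ_ne_zero t)
      · exact ih (t + 1)
  have hlim : Tendsto (fun n : ℕ => ‖p‖ ^ n * (M + M)) atTop (𝓝 0) := by
    simpa using (tendsto_pow_atTop_nhds_zero_of_lt_one (norm_nonneg p) hp).mul_const (M + M)
  have h0 : ‖F t - F (t + 1)‖ ≤ 0 := ge_of_tendsto' hlim fun n => hbound n t
  exact (sub_eq_zero.mp (norm_le_zero_iff.mp h0)).symm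

/-- As `t` grows, only the term `s = 0` survives. Since the sum does not depend on `t`, this limit
is its value. -/
theorem tendsto_tsum_durfeeTerm {p : ℂ} (hp : ‖p‖ < 1) :
    Tendsto (fun t => ∑' s, durfeeTerm p t s) atTop (𝓝 (qPochInf p p)⁻¹) := by
  obtain ⟨C, -, hC⟩ := exists_norm_qPoch_self_inv_le hp
  have h := tendsto_tsum_of_dominated_convergence (𝓕 := atTop) (f := durfeeTerm p)
    (g := fun s : ℕ => if s = 0 then (qPochInf p p)⁻¹ else 0)
    (bound := fun s => ‖p‖ ^ s * (C * C))
    ((summable_geometric_of_lt_one (norm_nonneg p) hp).mul_right (C * C)) (fun s => ?_)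
    (Eventually.of_forall fun t s => norm_durfeeTerm_le hp hC t s)
  · simpa using h
  · have hinv := (tendsto_qPoch (a := p) hp).inv₀ (qPochInf_self_ne_zero hp)
    have hshift : Tendsto (fun t => (qPoch p p (s + t))⁻¹) atTop (𝓝 (qPochInf p p)⁻¹) :=
      hinv.comp (tendsto_atTop_mono (fun t => Nat.le_add_left t s) tendsto_id)
    by_cases hs : s = 0
    · subst hs
      simpa [durfeeTerm, qPoch] using hinv
    · rw [if_neg hs]
      have hpow : Tendsto (fun t : ℕ => p ^ (s ^ 2 + t * s)) atTop (𝓝 0) := by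
        refine (tendsto_pow_atTop_nhds_zero_of_norm_lt_one hp).comp
          (tendsto_atTop_mono (fun t => ?_) tendsto_id)
        have := Nat.one_le_iff_ne_zero.mpr hs
        simp only [id]
        nlinarith
      simpa [durfeeTerm] using hpow.mul (tendsto_const_nhds.mul hshift)

/-- Durfee rectangle identity: `∑ p ^ (s ^ 2 + t s) / ((p)_s (p)_{s + t}) = 1 / (p)_∞`. -/
theorem hasSum_durfeeTerm {p : ℂ} (hp : ‖p‖ < 1) (t : ℕ) :
    HasSum (durfeeTerm p t) (qPochInf p p)⁻¹ := by
  have hconst : ∀ t, ∑' s, durfeeTerm p t s = ∑' s, durfeeTerm p 0 s := by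
    intro t
    induction t with
    | zero => rfl
    | succ t ih => rw [tsum_durfeeTerm_succ hp, ih]
  have h0 : ∑' s, durfeeTerm p 0 s = (qPochInf p p)⁻¹ :=
    tendsto_nhds_unique (tendsto_const_nhds.congr fun t => (hconst t).symm)
      (tendsto_tsum_durfeeTerm hp)
  rw [← h0, ← hconst t]
  exact (summable_durfeeTerm hp t).hasSum

/-! ### Gaussian polynomials and Rothe's identity -/

theorem qBinom_natCast {q : ℂ} {n k : ℕ} (h : k ≤ n) :
    qBinom q n k = qPoch q q n / (qPoch q q k * qPoch q q (n - k)) := by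
  simp [qBinom, h]

theorem qBinom_natCast_of_lt {q : ℂ} {n k : ℕ} (h : n < k) : qBinom q n k = 0 := by
  simp [qBinom, h]

theorem qBinom_zero_right {q : ℂ} (hq : ‖q‖ < 1) (n : ℕ) : qBinom q n (0 : ℕ) = 1 := by
  rw [qBinom_natCast (Nat.zero_le n), Nat.sub_zero, show qPoch q q 0 = 1 from rfl, one_mul,
    div_self (qPoch_self_ne_zero hq n)]

theorem qBinom_succ_succ {q : ℂ} (hq : ‖q‖ < 1) {n k : ℕ} (h : k ≤ n) :
    qBinom q (n + 1 : ℕ) (k + 1 : ℕ) =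
      qBinom q n (k + 1 : ℕ) + q ^ (n - k) * qBinom q n (k : ℕ) := by
  obtain ⟨d, rfl⟩ := Nat.exists_eq_add_of_le h
  have hk := qPoch_self_ne_zero hq k
  have hk' := one_sub_pow_ne_zero hq k
  have hn := qPoch_self_ne_zero hq (k + d)
  have hn' := one_sub_pow_ne_zero hq (k + d)
  rw [qBinom_natCast (by omega : k + 1 ≤ k + d + 1), qBinom_natCast h]
  cases d with
  | zero =>
    rw [qBinom_natCast_of_lt (by omega : k + 0 < k + 1)]
    simp only [add_zero, Nat.sub_self, pow_zero, one_mul, zero_add] at *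
    have h1 := qPoch_self_ne_zero hq (k + 1)
    have h0 := qPoch_self_ne_zero hq 0
    field_simp
  | succ d =>
    have hd := qPoch_self_ne_zero hq d
    have hd' := one_sub_pow_ne_zero hq d
    rw [qBinom_natCast (by omega : k + 1 ≤ k + (d + 1)),
      show k + (d + 1) + 1 - (k + 1) = d + 1 by omega, show k + (d + 1) - k = d + 1 by omega,
      show k + (d + 1) - (k + 1) = d by omega, qPoch_self_succ q (k + (d + 1)),
      qPoch_self_succ q k, qPoch_self_succ q d]
    field_simp
    ring

/-- Finite `q`-binomial theorem (Rothe). -/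
theorem sum_qBinom_mul_pow {q : ℂ} (hq : ‖q‖ < 1) (x : ℂ) (n : ℕ) :
    ∑ k ∈ Finset.range (n + 1), (-1) ^ k * q ^ (k.choose 2) * qBinom q n k * x ^ k =
      qPoch x q n := by
  induction n with
  | zero => simp [qBinom, qPoch]
  | succ n ih =>
    have hsplit : ∀ k ∈ Finset.range (n + 1),
        (-1 : ℂ) ^ (k + 1) * q ^ ((k + 1).choose 2) * qBinom q (n + 1 : ℕ) (k + 1 : ℕ) *
          x ^ (k + 1) =
        (-1) ^ (k + 1) * q ^ ((k + 1).choose 2) * qBinom q n (k + 1 : ℕ) * x ^ (k + 1) -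
          x * q ^ n * ((-1) ^ k * q ^ (k.choose 2) * qBinom q n k * x ^ k) := by
      intro k hk
      have hkn : k ≤ n := Nat.lt_succ_iff.mp (Finset.mem_range.mp hk)
      have hpow : q ^ ((k + 1).choose 2) * q ^ (n - k) = q ^ n * q ^ (k.choose 2) := by
        have hc : (k + 1).choose 2 = k + k.choose 2 := by
          rw [Nat.choose_succ_succ' k 1, Nat.choose_one_right]
        rw [← pow_add, ← pow_add, hc]
        congr 1
        omega
      rw [qBinom_succ_succ hq hkn]
      linear_combination (-1 : ℂ) ^ (k + 1) * qBinom q n k * x ^ (k + 1) * hpow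
    rw [Finset.sum_range_succ', Finset.sum_congr rfl hsplit, Finset.sum_sub_distrib,
      ← Finset.mul_sum, ih, qPoch_succ, qBinom_zero_right hq]
    rw [Finset.sum_range_succ'] at ih
    rw [qBinom_zero_right hq] at ih
    rw [Finset.sum_range_succ, qBinom_natCast_of_lt (Nat.lt_succ_self n)]
    linear_combination ih

/-! ### Summation over `n` -/

/-- The summand `p ^ (n ^ 2) / ((p)_{n - r} (p)_{n + r})`, zero for `n < |r|`. -/
noncomputable def rectTerm (p : ℂ) (n : ℕ) (r : ℤ) : ℂ :=
  p ^ (n ^ 2) / qPoch p p (2 * n) * qBinom p (2 * n : ℕ) (n - r)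

theorem rectTerm_eq_zero {p : ℂ} {n : ℕ} {r : ℤ} (h : n < r.natAbs) : rectTerm p n r = 0 := by
  rw [rectTerm, qBinom, if_neg (by omega), mul_zero]

theorem rectTerm_add_natAbs {p : ℂ} (hp : ‖p‖ < 1) (s : ℕ) (r : ℤ) :
    rectTerm p (s + r.natAbs) r = p ^ ((s + r.natAbs) ^ 2) *
      ((qPoch p p s)⁻¹ * (qPoch p p (s + 2 * r.natAbs))⁻¹) := by
  have h0 := qPoch_self_ne_zero hp (2 * (s + r.natAbs))
  have h1 := qPoch_self_ne_zero hp s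
  have h2 := qPoch_self_ne_zero hp (s + 2 * r.natAbs)
  rw [rectTerm]
  rcases Int.natAbs_eq r with hr | hr
  · rw [show ((s + r.natAbs : ℕ) : ℤ) - r = (s : ℕ) by omega,
      qBinom_natCast (by omega),
      show 2 * (s + r.natAbs) - s = s + 2 * r.natAbs by omega]
    field_simp
  · rw [show ((s + r.natAbs : ℕ) : ℤ) - r = (s + 2 * r.natAbs : ℕ) by omega,
      qBinom_natCast (by omega),
      show 2 * (s + r.natAbs) - (s + 2 * r.natAbs) = s by omega]
    field_simp

/-- Putting `n = s + |r|` gives `n^2 = r^2 + s^2 + 2|r|s`, so this is the Durfee identity with `t =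
2|r|`. -/
theorem hasSum_rectTerm {p : ℂ} (hp : ‖p‖ < 1) (r : ℤ) :
    HasSum (fun n => rectTerm p n r) (p ^ (r.natAbs ^ 2) * (qPochInf p p)⁻¹) := by
  rw [← hasSum_nat_add_iff' r.natAbs, Finset.sum_eq_zero fun n hn =>
    rectTerm_eq_zero (Finset.mem_range.mp hn), sub_zero]
  refine ((hasSum_durfeeTerm hp (2 * r.natAbs)).mul_left _).congr_fun fun s => ?_
  rw [rectTerm_add_natAbs hp, durfeeTerm]
  ring

theorem norm_rectTerm_le {p : ℂ} (hp : ‖p‖ < 1) {C : ℝ} (hC : ∀ n, ‖(qPoch p p n)⁻¹‖ ≤ C)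
    (n : ℕ) (r : ℤ) : ‖rectTerm p n r‖ ≤ ‖p‖ ^ n * (C * C) := by
  have hC0 : 0 ≤ C := (norm_nonneg _).trans (hC 0)
  rcases lt_or_ge n r.natAbs with h | h
  · rw [rectTerm_eq_zero h, norm_zero]
    positivity
  · obtain ⟨s, rfl⟩ := Nat.exists_eq_add_of_le' h
    rw [rectTerm_add_natAbs hp, norm_mul, norm_mul, norm_pow]
    exact mul_le_mul
      (pow_le_pow_of_le_one (norm_nonneg p) hp.le (Nat.le_self_pow two_ne_zero _))
      (mul_le_mul (hC _) (hC _) (norm_nonneg _) hC0) (by positivity) (by positivity)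

/-! ### Theta coefficients -/

/-- The theta coefficient `(-1) ^ m q ^ (m (m + 1) / 2)`. -/
noncomputable def thetaCoeff (q : ℂ) (m : ℤ) : ℂ :=
  (-1) ^ m * q ^ (m * (m + 1) / 2)

theorem thetaCoeff_add_one {q : ℂ} (hq : q ≠ 0) (m : ℤ) :
    thetaCoeff q (m + 1) = -(q ^ (m + 1) * thetaCoeff q m) := by
  rw [thetaCoeff, thetaCoeff, show (m + 1) * (m + 1 + 1) = m * (m + 1) + (m + 1) * 2 by ring,
    Int.add_mul_ediv_right _ _ two_ne_zero, zpow_add₀ hq, zpow_add₀ (by norm_num : (-1 : ℂ) ≠ 0),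
    zpow_one]
  ring

theorem thetaCoeff_natCast (q : ℂ) (n : ℕ) :
    thetaCoeff q n = (-1) ^ n * q ^ ((n + 1).choose 2) := by
  have h : (n : ℤ) * (n + 1) / 2 = ((n + 1).choose 2 : ℕ) := by
    rw [Nat.choose_two_right, Nat.add_sub_cancel, mul_comm (n + 1)]
    norm_cast
  rw [thetaCoeff, h, zpow_natCast, zpow_natCast]

theorem thetaCoeff_neg_sub_one (q : ℂ) (m : ℤ) : thetaCoeff q (-(m + 1)) = -thetaCoeff q m := by
  rw [thetaCoeff, thetaCoeff, show -(m + 1) * (-(m + 1) + 1) = m * (m + 1) by ring, zpow_neg,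
    zpow_add₀ (by norm_num : (-1 : ℂ) ≠ 0), mul_inv, ← inv_zpow]
  norm_num

theorem thetaCoeff_sub_natCast {q : ℂ} (hq : q ≠ 0) (N : ℤ) (k : ℕ) :
    thetaCoeff q (N - k) =
      thetaCoeff q N * ((-1) ^ k * q ^ (k.choose 2) * (q ^ (-N)) ^ k) := by
  induction k with
  | zero => simp
  | succ k ih =>
    have h := thetaCoeff_add_one hq (N - (k + 1 : ℕ))
    rw [show N - (k + 1 : ℕ) + 1 = N - k by push_cast; ring, ih] at h
    have hc : (k + 1).choose 2 = k + k.choose 2 := by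
      rw [Nat.choose_succ_succ' k 1, Nat.choose_one_right]
    have h1 : q ^ (N - k) * (q ^ k * q ^ (-N)) = 1 := by
      rw [← zpow_natCast, ← zpow_add₀ hq, ← zpow_add₀ hq, show N - k + (k + -N) = 0 by ring,
        zpow_zero]
    rw [hc, pow_add, pow_succ, pow_succ]
    linear_combination q ^ k * q ^ (-N) * h - thetaCoeff q (N - (k + 1 : ℕ)) * h1

theorem summable_norm_thetaCoeff {q : ℂ} (hq : ‖q‖ < 1) :
    Summable fun m => ‖thetaCoeff q m‖ := by
  have hs : Summable fun n : ℕ => ‖thetaCoeff q n‖ := by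
    refine Summable.of_nonneg_of_le (fun _ => norm_nonneg _) (fun n => ?_)
      (summable_geometric_of_lt_one (norm_nonneg q) hq)
    rw [thetaCoeff_natCast, norm_mul, norm_pow, norm_neg, norm_one, one_pow, one_mul, norm_pow]
    refine pow_le_pow_of_le_one (norm_nonneg q) hq.le ?_
    rw [Nat.choose_succ_succ' n 1, Nat.choose_one_right]
    exact Nat.le_add_right _ _
  exact hs.of_nat_of_neg_add_one (by simpa only [thetaCoeff_neg_sub_one, norm_neg] using hs)

/-- Each factor is `1 - q^(-i) = -q^(-i) (1 - q^i)` with `j < i ≤ j + ℓ`, and the `-q^(-i)` are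
exactly the ratios that lower the theta coefficient from `j + ℓ` to `j`. -/
theorem thetaCoeff_mul_qPoch {q : ℂ} (hq : q ≠ 0) (j ℓ : ℕ) :
    thetaCoeff q (j + ℓ : ℕ) * qPoch (q ^ (-((j + ℓ : ℕ) : ℤ))) q ℓ =
      thetaCoeff q j * qPoch (q ^ (j + 1)) q ℓ := by
  induction ℓ with
  | zero => simp [qPoch]
  | succ ℓ ih =>
    have hsplit : qPoch (q ^ (-((j + (ℓ + 1) : ℕ) : ℤ))) q (ℓ + 1) =
        (1 - q ^ (-((j + (ℓ + 1) : ℕ) : ℤ))) * qPoch (q ^ (-((j + ℓ : ℕ) : ℤ))) q ℓ := by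
      rw [qPoch, Finset.prod_range_succ', qPoch, mul_comm, pow_zero, mul_one]
      congr 1
      refine Finset.prod_congr rfl fun i _ => ?_
      rw [pow_succ', ← mul_assoc, ← zpow_add_one₀ hq]
      congr 4
      push_cast
      ring
    have h1 : q ^ (((j + ℓ : ℕ) : ℤ) + 1) * q ^ (-((j + (ℓ + 1) : ℕ) : ℤ)) = 1 := by
      rw [← zpow_add₀ hq, ← zpow_zero q]
      congr 1
      push_cast
      ring
    have h2 : q ^ (((j + ℓ : ℕ) : ℤ) + 1) = q ^ (j + 1) * q ^ ℓ := by
      rw [← pow_add, ← zpow_natCast]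
      congr 1
      push_cast
      ring
    rw [hsplit, show ((j + (ℓ + 1) : ℕ) : ℤ) = ((j + ℓ : ℕ) : ℤ) + 1 by push_cast; ring,
      thetaCoeff_add_one hq, qPoch_succ, ← mul_assoc (thetaCoeff q j), ← ih, ← h2]
    rw [show ((j + (ℓ + 1) : ℕ) : ℤ) = ((j + ℓ : ℕ) : ℤ) + 1 by push_cast; ring] at h1
    linear_combination thetaCoeff q (j + ℓ : ℕ) * qPoch (q ^ (-((j + ℓ : ℕ) : ℤ))) q ℓ * h1

theorem qPoch_zpow_neg_eq_zero {q : ℂ} (hq : q ≠ 0) {N ℓ : ℕ} (h : N < ℓ) :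
    qPoch (q ^ (-(N : ℤ))) q ℓ = 0 := by
  refine Finset.prod_eq_zero (Finset.mem_range.mpr h) ?_
  rw [zpow_neg, zpow_natCast, inv_mul_cancel₀ (pow_ne_zero _ hq), sub_self]

/-- Shifting the theta coefficient by `k` produces the Rothe weight at `x = q^(-N)`. -/
theorem sum_thetaCoeff_sub_mul_qBinom {q : ℂ} (hq0 : q ≠ 0) (hq : ‖q‖ < 1) (N : ℤ) (ℓ : ℕ) :
    ∑ k ∈ Finset.range (ℓ + 1), thetaCoeff q (N - k) * qBinom q ℓ k =
      thetaCoeff q N * qPoch (q ^ (-N)) q ℓ := by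
  rw [← sum_qBinom_mul_pow hq, Finset.mul_sum]
  refine Finset.sum_congr rfl fun k _ => ?_
  rw [thetaCoeff_sub_natCast hq0]
  ring

/-! ### The series over `N = m + k` and its reflection -/

/-- The value of `q ^ (r ^ 2) ∑ₙ rectTerm (q ^ 2) n r`, up to the factor `1 / (q ^ 2; q ^ 2)_∞`,
differenced in `r`. -/
noncomputable def cubeDiff (q : ℂ) (r : ℤ) : ℂ :=
  q ^ (3 * r.natAbs ^ 2) - q ^ (3 * (r + 2).natAbs ^ 2)

theorem norm_cubeDiff_le {q : ℂ} (hq : ‖q‖ < 1) (r : ℤ) : ‖cubeDiff q r‖ ≤ 2 := by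
  have h : ∀ n : ℕ, ‖q ^ n‖ ≤ 1 := fun n => by
    rw [norm_pow]
    exact pow_le_one₀ (norm_nonneg q) hq.le
  exact (norm_sub_le _ _).trans (by linarith [h (3 * r.natAbs ^ 2), h (3 * (r + 2).natAbs ^ 2)])

theorem cubeDiff_natCast (q : ℂ) (x : ℕ) :
    cubeDiff q x = q ^ (3 * x ^ 2) * (1 - q ^ (12 * (x + 1))) := by
  rw [cubeDiff, mul_sub, mul_one, ← pow_add, Int.natAbs_natCast,
    show ((x : ℤ) + 2).natAbs = x + 2 by omega]
  ring_nf

theorem cubeDiff_neg_sub_two (q : ℂ) (r : ℤ) : cubeDiff q (-r - 2) = -cubeDiff q r := by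
  rw [cubeDiff, cubeDiff, show (-r - 2).natAbs = (r + 2).natAbs by omega,
    show (-r - 2 + 2).natAbs = r.natAbs by omega, neg_sub]

/-- The `j`-th summand of the right-hand side. -/
noncomputable def rhsTerm (q : ℂ) (ℓ j : ℕ) : ℂ :=
  (-1 : ℂ) ^ j * q ^ (Nat.choose (j + 1) 2 + 3 * (2 * j + ℓ) ^ 2)
    * (1 - q ^ (12 * (2 * j + ℓ + 1))) * qPoch (q ^ (j + 1)) q ℓ

theorem rhsTerm_eq (q : ℂ) (ℓ j : ℕ) :
    rhsTerm q ℓ j =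
      thetaCoeff q j * qPoch (q ^ (j + 1)) q ℓ * cubeDiff q (2 * j + ℓ : ℕ) := by
  rw [rhsTerm, thetaCoeff_natCast, cubeDiff_natCast, pow_add]
  ring

/-- The left-hand side summed over `n`, as a series over `N = m + k`. -/
noncomputable def diagTerm (q : ℂ) (ℓ : ℕ) (N : ℤ) : ℂ :=
  thetaCoeff q N * qPoch (q ^ (-N)) q ℓ * cubeDiff q (2 * N - ℓ)

theorem diagTerm_natCast_add {q : ℂ} (hq : q ≠ 0) (ℓ j : ℕ) :
    diagTerm q ℓ (j + ℓ : ℕ) = rhsTerm q ℓ j := by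
  rw [diagTerm, thetaCoeff_mul_qPoch hq, rhsTerm_eq]
  congr 2
  push_cast
  ring

/-- The reflection changes the sign of both the theta coefficient and `cubeDiff`, and the two signs
cancel. -/
theorem diagTerm_neg_add_one {q : ℂ} (ℓ j : ℕ) :
    diagTerm q ℓ (-(j + 1)) = rhsTerm q ℓ j := by
  rw [diagTerm, thetaCoeff_neg_sub_one, rhsTerm_eq, neg_neg,
    show 2 * (-((j : ℤ) + 1)) - ℓ = -((2 * j + ℓ : ℕ) : ℤ) - 2 by push_cast; ring,
    cubeDiff_neg_sub_two, show q ^ ((j : ℤ) + 1) = q ^ (j + 1) by exact_mod_cast zpow_natCast q _]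
  ring

theorem diagTerm_eq_zero {q : ℂ} (hq : q ≠ 0) {N ℓ : ℕ} (h : N < ℓ) : diagTerm q ℓ N = 0 := by
  rw [diagTerm, qPoch_zpow_neg_eq_zero hq h, mul_zero, zero_mul]

theorem summable_rhsTerm_of_summable_diagTerm {q : ℂ} (ℓ : ℕ)
    (h : Summable (diagTerm q ℓ)) : Summable (rhsTerm q ℓ) := by
  have hinj : Function.Injective fun j : ℕ => -((j : ℤ) + 1) := fun a b hab => by
    simpa using hab
  simpa only [Function.comp_def, diagTerm_neg_add_one] using h.comp_injective hinj

theorem hasSum_diagTerm {q : ℂ} (hq : q ≠ 0) (ℓ : ℕ) (h : Summable (diagTerm q ℓ)) :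
    HasSum (diagTerm q ℓ) (2 * ∑' j, rhsTerm q ℓ j) := by
  have hR := (summable_rhsTerm_of_summable_diagTerm ℓ h).hasSum
  rw [two_mul]
  refine HasSum.of_nat_of_neg_add_one ?_ ?_
  -- The terms with `0 ≤ N < ℓ` vanish, so the nonnegative half starts at `N = ℓ`.
  · rw [← hasSum_nat_add_iff' ℓ, Finset.sum_eq_zero fun n hn =>
      diagTerm_eq_zero hq (Finset.mem_range.mp hn), sub_zero]
    simpa only [diagTerm_natCast_add hq] using hR
  · simpa only [diagTerm_neg_add_one] using hR

/-! ### The sum over `m` and `k` -/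

/-- The summand of the left-hand side after summing over `n`. -/
noncomputable def colTerm (q : ℂ) (ℓ k : ℕ) (m : ℤ) : ℂ :=
  thetaCoeff q m * qBinom q ℓ k * cubeDiff q (2 * (m + k) - ℓ)

theorem summable_colTerm {q : ℂ} (hq : ‖q‖ < 1) (ℓ k : ℕ) : Summable (colTerm q ℓ k) := by
  refine Summable.of_norm_bounded
    (((summable_norm_thetaCoeff hq).mul_right ‖qBinom q ℓ k‖).mul_right 2) fun m => ?_
  rw [colTerm, norm_mul, norm_mul]
  exact mul_le_mul_of_nonneg_left (norm_cubeDiff_le hq _) (by positivity)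

theorem hasSum_sum_colTerm {q : ℂ} (hq0 : q ≠ 0) (hq : ‖q‖ < 1) (ℓ : ℕ) :
    Summable (rhsTerm q ℓ) ∧
    HasSum (fun m => ∑ k ∈ Finset.range (ℓ + 1), colTerm q ℓ k m)
      (2 * ∑' j, rhsTerm q ℓ j) := by
  -- For each fixed `k`, substitute `m = N - k`; the finite sum over `k` can then be taken inside
  -- the series over `N`.
  have hshift : ∀ k : ℕ, HasSum (fun N : ℤ => colTerm q ℓ k (N - k)) (∑' m, colTerm q ℓ k m) :=
    fun k => (Equiv.subRight (k : ℤ)).hasSum_iff.mpr (summable_colTerm hq ℓ k).hasSum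
  have hdiag := hasSum_sum fun k (_ : k ∈ Finset.range (ℓ + 1)) => hshift k
  have he : (fun N : ℤ => ∑ k ∈ Finset.range (ℓ + 1), colTerm q ℓ k (N - k)) = diagTerm q ℓ := by
    funext N
    simp only [colTerm, sub_add_cancel]
    rw [← Finset.sum_mul, sum_thetaCoeff_sub_mul_qBinom hq0 hq, diagTerm]
  rw [he] at hdiag
  refine ⟨summable_rhsTerm_of_summable_diagTerm ℓ hdiag.summable, ?_⟩
  rw [(hasSum_diagTerm hq0 ℓ hdiag.summable).unique hdiag]
  exact hasSum_sum fun k _ => (summable_colTerm hq ℓ k).hasSum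

/-! ### The double series over `n` and `m` -/

/-- The difference of two consecutive weighted rectangle summands. -/
noncomputable def rectDiff (q : ℂ) (n : ℕ) (r : ℤ) : ℂ :=
  q ^ (r.natAbs ^ 2) * rectTerm (q ^ 2) n r
    - q ^ ((r + 2).natAbs ^ 2) * rectTerm (q ^ 2) n (r + 2)

theorem norm_sq_lt_one {q : ℂ} (hq : ‖q‖ < 1) : ‖q ^ 2‖ < 1 := by
  rw [norm_pow]
  exact pow_lt_one₀ (norm_nonneg q) hq two_ne_zero

theorem hasSum_rectDiff {q : ℂ} (hq : ‖q‖ < 1) (r : ℤ) :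
    HasSum (fun n => rectDiff q n r) (cubeDiff q r * (qPochInf (q ^ 2) (q ^ 2))⁻¹) := by
  have h := ((hasSum_rectTerm (norm_sq_lt_one hq) r).mul_left (q ^ (r.natAbs ^ 2))).sub
    ((hasSum_rectTerm (norm_sq_lt_one hq) (r + 2)).mul_left (q ^ ((r + 2).natAbs ^ 2)))
  have hval : cubeDiff q r * (qPochInf (q ^ 2) (q ^ 2))⁻¹ =
      q ^ (r.natAbs ^ 2) * ((q ^ 2) ^ (r.natAbs ^ 2) * (qPochInf (q ^ 2) (q ^ 2))⁻¹) -
        q ^ ((r + 2).natAbs ^ 2) *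
          ((q ^ 2) ^ ((r + 2).natAbs ^ 2) * (qPochInf (q ^ 2) (q ^ 2))⁻¹) := by
    rw [cubeDiff]
    ring
  rw [hval]
  exact h

theorem norm_rectDiff_le {q : ℂ} (hq : ‖q‖ < 1) {C : ℝ}
    (hC : ∀ n, ‖(qPoch (q ^ 2) (q ^ 2) n)⁻¹‖ ≤ C) (n : ℕ) (r : ℤ) :
    ‖rectDiff q n r‖ ≤ 2 * (‖q ^ 2‖ ^ n * (C * C)) := by
  have h : ∀ (e : ℕ) (s : ℤ), ‖q ^ e * rectTerm (q ^ 2) n s‖ ≤ ‖q ^ 2‖ ^ n * (C * C) := by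
    intro e s
    rw [norm_mul, norm_pow q e]
    exact (mul_le_of_le_one_left (norm_nonneg _) (pow_le_one₀ (norm_nonneg q) hq.le)).trans
      (norm_rectTerm_le (norm_sq_lt_one hq) hC n s)
  rw [two_mul]
  exact (norm_sub_le _ _).trans (add_le_add (h _ _) (h _ _))

theorem rectDiff_eq_zero {q : ℂ} {n : ℕ} {r : ℤ} (h : n + 2 < r.natAbs) : rectDiff q n r = 0 := by
  rw [rectDiff, rectTerm_eq_zero (by omega), rectTerm_eq_zero (by omega), mul_zero, mul_zero,
    sub_zero]

theorem rectDiff_eq {q : ℂ} (hq : q ≠ 0) (n : ℕ) (r : ℤ) :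
    rectDiff q n r = q ^ (2 * n ^ 2) / qPoch (q ^ 2) (q ^ 2) (2 * n) * (q ^ (r ^ 2) *
      (qBinom (q ^ 2) (2 * n : ℕ) (n - r)
        - q ^ (4 * (r + 1)) * qBinom (q ^ 2) (2 * n : ℕ) (n - r - 2))) := by
  have hsq : ∀ s : ℤ, q ^ (s.natAbs ^ 2) = q ^ (s ^ 2) := fun s => by
    rw [← Int.natAbs_sq, ← zpow_natCast]
    push_cast
    rfl
  have hadd : q ^ ((r + 2) ^ 2) = q ^ (r ^ 2) * q ^ (4 * (r + 1)) := by
    rw [← zpow_add₀ hq]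
    congr 1
    ring
  rw [rectDiff, hsq, hsq, hadd, rectTerm, rectTerm, ← pow_mul, ← sub_sub]
  ring

/-- The summand of the left-hand side, including the prefactor depending on `n`. -/
noncomputable def lhsTerm (q : ℂ) (ℓ n : ℕ) (m : ℤ) : ℂ :=
  ∑ k ∈ Finset.range (ℓ + 1), thetaCoeff q m * qBinom q ℓ k * rectDiff q n (2 * (m + k) - ℓ)

theorem hasSum_lhsTerm {q : ℂ} (hq : ‖q‖ < 1) (ℓ : ℕ) (m : ℤ) :
    HasSum (fun n => lhsTerm q ℓ n m)
      ((∑ k ∈ Finset.range (ℓ + 1), colTerm q ℓ k m) * (qPochInf (q ^ 2) (q ^ 2))⁻¹) := by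
  rw [Finset.sum_mul]
  refine hasSum_sum fun k _ => ?_
  rw [colTerm, mul_assoc]
  exact (hasSum_rectDiff hq _).mul_left _

theorem summable_lhsTerm {q : ℂ} (hq : ‖q‖ < 1) (ℓ : ℕ) :
    Summable fun x : ℕ × ℤ => lhsTerm q ℓ x.1 x.2 := by
  have hp := norm_sq_lt_one hq
  obtain ⟨C, -, hC⟩ := exists_norm_qPoch_self_inv_le hp
  refine summable_sum fun k _ => Summable.of_norm_bounded
    (((summable_geometric_of_lt_one (norm_nonneg _) hp).mul_of_nonneg
      (summable_norm_thetaCoeff hq) (fun n => by positivity)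
      (fun m => norm_nonneg _)).mul_right (2 * (‖qBinom q ℓ k‖ * (C * C)))) fun x => ?_
  rw [norm_mul, norm_mul]
  refine (mul_le_mul_of_nonneg_left (norm_rectDiff_le hq hC _ _) (by positivity)).trans_eq ?_
  ring

theorem hasSum_tsum_lhsTerm {q : ℂ} (hq0 : q ≠ 0) (hq : ‖q‖ < 1) (ℓ : ℕ) :
    HasSum (fun n => ∑' m, lhsTerm q ℓ n m)
      (2 / qPochInf (q ^ 2) (q ^ 2) * ∑' j, rhsTerm q ℓ j) := by
  have hs := summable_lhsTerm hq ℓ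
  -- Both iterated sums have the same total: summing over `n` first evaluates it, and summing over
  -- `m` first gives the left-hand side.
  have hcol : HasSum _ _ := ((Equiv.prodComm ℤ ℕ).hasSum_iff.mpr hs.hasSum).prod_fiberwise
    (hasSum_lhsTerm hq ℓ)
  have hval := hcol.unique ((hasSum_sum_colTerm hq0 hq ℓ).2.mul_right _)
  have hrow := hs.hasSum.prod_fiberwise fun n => (hs.prod_factor n).hasSum
  rw [hval] at hrow
  convert hrow using 1
  ring

/-! ### Assembly -/

theorem mainTheorem8 (q : ℂ) (hq0 : q ≠ 0) (hq1 : ‖q‖ < 1) (ℓ : ℕ) :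
    (∀ n : ℕ, (Function.support (fun m : ℤ =>
      ∑ k ∈ Finset.range (ℓ + 1),
        (-1 : ℂ) ^ m * q ^ ((2 * m + 2 * (k : ℤ) - ℓ) ^ 2 + m * (m + 1) / 2 : ℤ)
          * qBinom q ℓ k
          * (qBinom (q ^ 2) (2 * n) (n - 2 * m - 2 * k + ℓ)
              - q ^ (4 * (2 * m + 2 * (k : ℤ) - ℓ + 1) : ℤ)
                * qBinom (q ^ 2) (2 * n) (n - 2 * m - 2 * k + ℓ - 2)))).Finite) ∧
    Summable (fun j : ℕ =>
      (-1 : ℂ) ^ j * q ^ (Nat.choose (j + 1) 2 + 3 * (2 * j + ℓ) ^ 2)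
        * (1 - q ^ (12 * (2 * j + ℓ + 1))) * qPoch (q ^ (j + 1)) q ℓ) ∧
    HasSum
      (fun n : ℕ =>
        q ^ (2 * n ^ 2) / qPoch (q ^ 2) (q ^ 2) (2 * n)
          * ∑' m : ℤ, ∑ k ∈ Finset.range (ℓ + 1),
              (-1 : ℂ) ^ m * q ^ ((2 * m + 2 * (k : ℤ) - ℓ) ^ 2 + m * (m + 1) / 2 : ℤ)
                * qBinom q ℓ k
                * (qBinom (q ^ 2) (2 * n) (n - 2 * m - 2 * k + ℓ)
                    - q ^ (4 * (2 * m + 2 * (k : ℤ) - ℓ + 1) : ℤ)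
                      * qBinom (q ^ 2) (2 * n) (n - 2 * m - 2 * k + ℓ - 2)))
      (2 / qPochInf (q ^ 2) (q ^ 2)
        * ∑' j : ℕ,
            (-1 : ℂ) ^ j * q ^ (Nat.choose (j + 1) 2 + 3 * (2 * j + ℓ) ^ 2)
              * (1 - q ^ (12 * (2 * j + ℓ + 1))) * qPoch (q ^ (j + 1)) q ℓ) := by
  -- The prefactor is nonzero, so the support of the bare inner summand can be read off from
  -- `lhsTerm`.
  have hpre : ∀ n : ℕ, q ^ (2 * n ^ 2) / qPoch (q ^ 2) (q ^ 2) (2 * n) ≠ 0 := fun n =>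
    div_ne_zero (pow_ne_zero _ hq0) (qPoch_self_ne_zero (norm_sq_lt_one hq1) _)
  have hterm : ∀ (n : ℕ) (m : ℤ), q ^ (2 * n ^ 2) / qPoch (q ^ 2) (q ^ 2) (2 * n) *
      ∑ k ∈ Finset.range (ℓ + 1),
        (-1 : ℂ) ^ m * q ^ ((2 * m + 2 * (k : ℤ) - ℓ) ^ 2 + m * (m + 1) / 2 : ℤ)
          * qBinom q ℓ k
          * (qBinom (q ^ 2) (2 * n) (n - 2 * m - 2 * k + ℓ)
              - q ^ (4 * (2 * m + 2 * (k : ℤ) - ℓ + 1) : ℤ)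
                * qBinom (q ^ 2) (2 * n) (n - 2 * m - 2 * k + ℓ - 2)) = lhsTerm q ℓ n m := by
    intro n m
    rw [lhsTerm, Finset.mul_sum]
    refine Finset.sum_congr rfl fun k _ => ?_
    rw [rectDiff_eq hq0, thetaCoeff, zpow_add₀ hq0,
      show 2 * (m + (k : ℤ)) - ℓ = 2 * m + 2 * k - ℓ by ring,
      show (n : ℤ) - (2 * m + 2 * k - ℓ) = n - 2 * m - 2 * k + ℓ by ring]
    ring
  refine ⟨fun n => ?_, (hasSum_sum_colTerm hq0 hq1 ℓ).1, ?_⟩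
  -- A nonzero term needs `|2(m + k) - ℓ| ≤ n + 2` for some `k ≤ ℓ`; this interval for `m` is a
  -- generous consequence.
  · refine (Set.finite_Icc (-(n + 2 + 2 * ℓ : ℤ)) (n + 2 + 2 * ℓ)).subset fun m hm => ?_
    by_contra hmem
    refine mul_ne_zero (hpre n) hm ((hterm n m).trans (Finset.sum_eq_zero fun k hk => ?_))
    rw [Finset.mem_range] at hk
    rw [Set.mem_Icc] at hmem
    rw [rectDiff_eq_zero (by omega), mul_zero]
  · refine (hasSum_tsum_lhsTerm hq0 hq1 ℓ).congr_fun fun n => ?_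
    rw [← tsum_mul_left]
    exact tsum_congr (hterm n)
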